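/- Let $\mathcal F^2$ be the Fock space of all entire functions $f$ with $\frac1\pi\int_{\mathbb C}|f(z)|^2e^{-|z|^2}\,dV(z)<\infty$, a Hilbert space with the inner product $\langle f,g\rangle=\frac1\pi\int_{\mathbb C}f(z)\overline{g(z)}e^{-|z|^2}\,dV(z)$, where $dV$ is Lebesgue measure on $\mathbb C$. Let $\psi,\varphi:\mathbb C\to\mathbb C$ be entire functions with $\psi\not\equiv0$, and let $W=W_{\psi,\varphi,\max}$ be the maximal weighted composition operator on $\mathcal F^2$, that is, $$\operatorname{dom}(W)=\{f\in\mathcal F^2:\ \psi\cdot(f\circ\varphi)\in\mathcal F^2\},\qquad Wf=\psi\cdot(f\circ\varphi)\quad(f\in\operatorname{dom}(W)).$$ Then the following assertions are equivalent. 1. $W$ is Hermitian, that is, $W$ is closed, densely defined, and $W=W^*$. 2. $W$ is densely defined and $W^*\preceq W$, that is, $W$ is an extension of its adjoint $W^*$. 3. There are $A\in\mathbb R$, $C\in\mathbb R\setminus\{0\}$ and $B\in\mathbb C$ such that $\varphi(z)=Az+B$ and $\psi(z)=Ce^{\overline Bz}$ for all $z\in\mathbb C$. -/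

import Mathlib

open MeasureTheory Filter Topology
open scoped ComplexConjugate ENNReal

noncomputable section

namespace Fock

/-- The Gaussian measure `π⁻¹ e^{-|z|²} dV(z)` on `ℂ`, where `dV` is Lebesgue measure. -/
def gaussianMeasure : Measure ℂ :=
  volume.withDensity fun z => ENNReal.ofReal (Real.pi⁻¹ * Real.exp (-‖z‖ ^ 2))

theorem measurable_density :
    Measurable fun z : ℂ => ENNReal.ofReal (Real.pi⁻¹ * Real.exp (-‖z‖ ^ 2)) := by
  fun_prop

theorem density_ne_zero (z : ℂ) : ENNReal.ofReal (Real.pi⁻¹ * Real.exp (-‖z‖ ^ 2)) ≠ 0 := by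
  have : 0 < Real.pi⁻¹ * Real.exp (-‖z‖ ^ 2) := by positivity
  simpa using this

theorem volume_absolutelyContinuous : (volume : Measure ℂ) ≪ gaussianMeasure :=
  withDensity_absolutelyContinuous' measurable_density.aemeasurable
    (Eventually.of_forall density_ne_zero)

instance : gaussianMeasure.IsOpenPosMeasure :=
  volume_absolutelyContinuous.isOpenPosMeasure

instance : IsProbabilityMeasure gaussianMeasure := by
  constructor
  have h := GaussianFourier.integral_rexp_neg_mul_sq_norm (V := ℂ) (b := 1) one_pos
  have hi : Integrable (fun z : ℂ => Real.exp (-‖z‖ ^ 2)) := by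
    by_contra hc
    have := integral_undef hc
    simp only [neg_mul, one_mul, div_one, Complex.finrank_real_complex] at h
    rw [this] at h
    norm_num at h
    exact Real.pi_ne_zero h.symm
  rw [gaussianMeasure, withDensity_apply _ MeasurableSet.univ, Measure.restrict_univ,
    ← ofReal_integral_eq_lintegral_ofReal (hi.const_mul _)
      (Eventually.of_forall fun z => by positivity), integral_const_mul]
  simp only [neg_mul, one_mul, div_one, Complex.finrank_real_complex] at h
  rw [h]
  norm_num [Real.pi_ne_zero]

/-- The entire functions which are square integrable with respect to the Gaussian measure,
as a linear subspace of the space of all functions `ℂ → ℂ`. -/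
def fockSubmodule : Submodule ℂ (ℂ → ℂ) where
  carrier := {f | Differentiable ℂ f ∧ MemLp f 2 gaussianMeasure}
  zero_mem' := ⟨differentiable_const 0, MemLp.zero⟩
  add_mem' hf hg := ⟨hf.1.add hg.1, hf.2.add hg.2⟩
  smul_mem' c _ hf := ⟨hf.1.const_smul c, hf.2.const_smul c⟩

/-- The Fock space `F²`. A separate type, so that its topology is that of the `L²` norm and not
the topology of pointwise convergence inherited from `ℂ → ℂ`. -/
def FockSpace : Type := fockSubmodule

instance : AddCommGroup FockSpace := inferInstanceAs (AddCommGroup fockSubmodule)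
instance : Module ℂ FockSpace := inferInstanceAs (Module ℂ fockSubmodule)

/-- The entire function underlying an element of the Fock space, as a linear map. -/
def toFunₗ : FockSpace →ₗ[ℂ] (ℂ → ℂ) := fockSubmodule.subtype

instance : CoeFun FockSpace fun _ => ℂ → ℂ := ⟨fun f => toFunₗ f⟩

/-- A function in `fockSubmodule` as an element of the Fock space. -/
def FockSpace.mk (f : ℂ → ℂ) (hf : f ∈ fockSubmodule) : FockSpace := (⟨f, hf⟩ : fockSubmodule)

@[simp] theorem FockSpace.coe_mk (f : ℂ → ℂ) (hf : f ∈ fockSubmodule) :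
    (FockSpace.mk f hf : ℂ → ℂ) = f := rfl

theorem FockSpace.mem (f : FockSpace) : (f : ℂ → ℂ) ∈ fockSubmodule := Subtype.property f

theorem FockSpace.differentiable (f : FockSpace) : Differentiable ℂ f := f.mem.1

theorem FockSpace.memLp (f : FockSpace) : MemLp f 2 gaussianMeasure := f.mem.2

theorem FockSpace.ext {f g : FockSpace} (h : ∀ z, f z = g z) : f = g :=
  Subtype.ext (funext h)

/-- The embedding of the Fock space into `L²` of the Gaussian measure. -/
def toL2 : FockSpace →ₗ[ℂ] Lp ℂ 2 gaussianMeasure where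
  toFun f := f.memLp.toLp f
  map_add' f g := by
    rw [← MemLp.toLp_add f.memLp g.memLp]
    rfl
  map_smul' c f := by
    rw [RingHom.id_apply, ← MemLp.toLp_const_smul c f.memLp]
    rfl

theorem coeFn_toL2 (f : FockSpace) : toL2 f =ᵐ[gaussianMeasure] f := f.memLp.coeFn_toLp

theorem toL2_injective : Function.Injective toL2 := by
  intro f g h
  have h1 : (f : ℂ → ℂ) =ᵐ[gaussianMeasure] g :=
    (coeFn_toL2 f).symm.trans ((by rw [h]) : _ =ᵐ[gaussianMeasure] _) |>.trans (coeFn_toL2 g)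
  have h2 := Measure.eq_of_ae_eq h1 f.differentiable.continuous g.differentiable.continuous
  exact FockSpace.ext fun z => congrFun h2 z

/-- The norm of the Fock space is the `L²` norm. -/
instance : NormedAddCommGroup FockSpace :=
  NormedAddCommGroup.induced FockSpace (Lp ℂ 2 gaussianMeasure) toL2 toL2_injective

theorem norm_def (f : FockSpace) : ‖f‖ = ‖toL2 f‖ := rfl

/-- The inner product of the Fock space. By Mathlib's convention it is conjugate linear in the
first variable, so `inner ℂ f g` is what is written `⟨g, f⟩` when an inner product is taken to be
linear in the first variable. -/
instance : Inner ℂ FockSpace where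
  inner f g := ∫ z, conj (f z) * g z ∂gaussianMeasure

theorem inner_def (f g : FockSpace) :
    inner ℂ f g = ∫ z, conj (f z) * g z ∂gaussianMeasure := rfl

theorem inner_eq_inner_toL2 (f g : FockSpace) : inner ℂ f g = inner ℂ (toL2 f) (toL2 g) := by
  rw [inner_def, L2.inner_def]
  refine integral_congr_ae ?_
  filter_upwards [coeFn_toL2 f, coeFn_toL2 g] with z hf hg
  rw [hf, hg, RCLike.inner_apply, mul_comm]

instance : InnerProductSpace ℂ FockSpace where
  norm_smul_le c f := by
    rw [norm_def, norm_def, map_smul]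
    exact norm_smul_le c _
  norm_sq_eq_re_inner f := by
    rw [inner_eq_inner_toL2, norm_def]
    exact norm_sq_eq_re_inner (𝕜 := ℂ) _
  conj_inner_symm f g := by
    rw [inner_eq_inner_toL2, inner_eq_inner_toL2]
    exact inner_conj_symm _ _
  add_left f g h := by
    simp only [inner_eq_inner_toL2, map_add, inner_add_left]
  smul_left f g c := by
    simp only [inner_eq_inner_toL2, map_smul, inner_smul_left]

/-- Area form of the mean value inequality on a disc of radius one. -/
theorem pi_mul_enorm_le_lintegral_ball {f : ℂ → ℂ} (hf : Differentiable ℂ f) (c : ℂ) :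
    ENNReal.ofReal Real.pi * ‖f c‖ₑ ≤ ∫⁻ w in Metric.ball c 1, ‖f w‖ₑ := by
  have hcont : Continuous f := hf.continuous
  have hcirc (r : ℝ) : ENNReal.ofReal (2 * Real.pi) * ‖f c‖ₑ ≤
      ∫⁻ θ in Set.Ioo (-Real.pi) Real.pi, ‖f (circleMap c r θ)‖ₑ := by
    have h1 : Real.circleAverage f c r = f c := hf.diffContOnCl.circleAverage
    rw [Real.circleAverage_eq_integral_add (-Real.pi),
      intervalIntegral.integral_comp_add_right (fun θ => f (circleMap c r θ))] at h1
    have h2 : ((2 * Real.pi : ℝ) : ℂ) * f c = ∫ θ in (-Real.pi)..Real.pi, f (circleMap c r θ) := by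
      rw [← h1, Complex.real_smul, ← mul_assoc, ← Complex.ofReal_mul,
        mul_inv_cancel₀ (by positivity), Complex.ofReal_one, one_mul]
      congr 1 <;> ring
    have h3 : ENNReal.ofReal (2 * Real.pi) * ‖f c‖ₑ = ‖((2 * Real.pi : ℝ) : ℂ) * f c‖ₑ := by
      rw [enorm_mul]
      congr 1
      rw [← ofReal_norm, Complex.norm_real, Real.norm_of_nonneg (by positivity)]
    rw [h3, h2, intervalIntegral.integral_of_le (by linarith [Real.pi_pos]),
      integral_Ioc_eq_integral_Ioo]
    exact enorm_integral_le_lintegral_enorm _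
  have hshift : ∫⁻ w in Metric.ball c 1, ‖f w‖ₑ =
      ∫⁻ w, (Metric.ball (0 : ℂ) 1).indicator (fun w => ‖f (c + w)‖ₑ) w := by
    rw [← lintegral_indicator Metric.isOpen_ball.measurableSet,
      ← lintegral_add_left_eq_self _ c]
    refine lintegral_congr fun w => ?_
    by_cases hw : ‖w‖ < 1 <;> simp [Set.indicator, hw]
  rw [hshift, ← Complex.lintegral_comp_polarCoord_symm]
  have hmeas : Measurable fun p : ℝ × ℝ => ENNReal.ofReal p.1 •
      (Metric.ball (0 : ℂ) 1).indicator (fun w => ‖f (c + w)‖ₑ) (Complex.polarCoord.symm p) := by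
    have h1 : Measurable fun p : ℝ × ℝ => Complex.polarCoord.symm p := by
      simp only [Complex.polarCoord_symm_apply]
      fun_prop
    have h2 : Measurable ((Metric.ball (0 : ℂ) 1).indicator (fun w => ‖f (c + w)‖ₑ)) :=
      Measurable.indicator (hcont.measurable.comp (measurable_const_add c)).enorm
        Metric.isOpen_ball.measurableSet
    exact (by fun_prop : Measurable fun p : ℝ × ℝ => ENNReal.ofReal p.1).smul (h2.comp h1)
  rw [polarCoord_target, Measure.volume_eq_prod, ← Measure.prod_restrict,
    lintegral_prod _ hmeas.aemeasurable]
  calc ENNReal.ofReal Real.pi * ‖f c‖ₑ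
      = ∫⁻ r in Set.Ioo (0 : ℝ) 1, ENNReal.ofReal r * (ENNReal.ofReal (2 * Real.pi) * ‖f c‖ₑ) := by
        rw [lintegral_mul_const _ (by fun_prop), ← ofReal_integral_eq_lintegral_ofReal,
          ← integral_Ioc_eq_integral_Ioo, ← intervalIntegral.integral_of_le zero_le_one,
          integral_id, ← mul_assoc, ← ENNReal.ofReal_mul (by norm_num)]
        · congr 2
          ring
        · exact (continuous_id.integrableOn_Icc (a := (0 : ℝ)) (b := 1)).mono_set
            Set.Ioo_subset_Icc_self
        · filter_upwards [ae_restrict_mem measurableSet_Ioo] with r hr using hr.1.le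
    _ ≤ ∫⁻ r in Set.Ioo (0 : ℝ) 1, ∫⁻ θ in Set.Ioo (-Real.pi) Real.pi, ENNReal.ofReal r •
          (Metric.ball (0 : ℂ) 1).indicator (fun w => ‖f (c + w)‖ₑ)
            (Complex.polarCoord.symm (r, θ)) := by
        refine setLIntegral_mono' measurableSet_Ioo fun r hr => ?_
        have h1 (θ : ℝ) : (Metric.ball (0 : ℂ) 1).indicator (fun w => ‖f (c + w)‖ₑ)
            (Complex.polarCoord.symm (r, θ)) = ‖f (circleMap c r θ)‖ₑ := by
          have hmem : Complex.polarCoord.symm (r, θ) ∈ Metric.ball (0 : ℂ) 1 := by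
            rw [mem_ball_zero_iff, Complex.norm_polarCoord_symm, abs_of_pos hr.1]
            exact hr.2
          rw [Set.indicator_of_mem hmem, Complex.polarCoord_symm_apply, circleMap,
            Complex.exp_mul_I, Complex.ofReal_cos, Complex.ofReal_sin]
        simp only [h1, smul_eq_mul]
        have h2 : Measurable fun θ => ‖f (circleMap c r θ)‖ₑ :=
          (hcont.comp (continuous_circleMap c r)).measurable.enorm
        rw [lintegral_const_mul _ h2]
        gcongr
        exact hcirc r
    _ ≤ _ := lintegral_mono_set Set.Ioo_subset_Ioi_self

/-- Point evaluations are bounded on the Fock space, locally uniformly in the point. -/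
theorem norm_apply_le (f : FockSpace) (z : ℂ) : ‖f z‖ ≤ Real.exp ((‖z‖ + 1) ^ 2) * ‖f‖ := by
  have h1 := pi_mul_enorm_le_lintegral_ball f.differentiable z
  have h2 : ∫⁻ w in Metric.ball z 1, ‖f w‖ₑ ≤
      ENNReal.ofReal (Real.pi * Real.exp ((‖z‖ + 1) ^ 2)) * ∫⁻ w, ‖f w‖ₑ ∂gaussianMeasure := by
    have hm : Measurable fun w => ‖f w‖ₑ := f.differentiable.continuous.measurable.enorm
    rw [gaussianMeasure, lintegral_withDensity_eq_lintegral_mul _ measurable_density hm,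
      ← lintegral_const_mul _ (measurable_density.mul hm)]
    refine le_trans ?_ (setLIntegral_le_lintegral (Metric.ball z 1) _)
    refine setLIntegral_mono' Metric.isOpen_ball.measurableSet fun w hw => ?_
    rw [Pi.mul_apply, ← mul_assoc, ← ENNReal.ofReal_mul (by positivity)]
    refine le_mul_of_one_le_left zero_le ?_
    rw [ENNReal.one_le_ofReal]
    have h3 : Real.pi * Real.exp ((‖z‖ + 1) ^ 2) * (Real.pi⁻¹ * Real.exp (-‖w‖ ^ 2)) =
        Real.exp ((‖z‖ + 1) ^ 2 - ‖w‖ ^ 2) := by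
      rw [sub_eq_add_neg, Real.exp_add]
      field_simp
    rw [h3, Real.one_le_exp_iff, sub_nonneg]
    have h4 : ‖w‖ ≤ ‖z‖ + 1 := by
      have h5 : ‖w - z‖ < 1 := mem_ball_iff_norm.1 hw
      linarith [norm_le_norm_add_norm_sub' w z]
    gcongr
  have h3 : ∫⁻ w, ‖f w‖ₑ ∂gaussianMeasure ≤ ENNReal.ofReal ‖f‖ := by
    rw [← eLpNorm_one_eq_lintegral_enorm]
    refine (eLpNorm_le_eLpNorm_of_exponent_le one_le_two f.memLp.1).trans ?_
    rw [norm_def]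
    change _ ≤ ENNReal.ofReal ‖f.memLp.toLp f‖
    rw [Lp.norm_toLp, ENNReal.ofReal_toReal f.memLp.2.ne]
  have h4 := h1.trans (h2.trans (mul_le_mul_right h3 _))
  rw [← ofReal_norm, ← ENNReal.ofReal_mul (by positivity),
    ← ENNReal.ofReal_mul (by positivity), ENNReal.ofReal_le_ofReal_iff (by positivity),
    mul_assoc] at h4
  exact le_of_mul_le_mul_left h4 Real.pi_pos

instance : CompleteSpace FockSpace := by
  refine Metric.complete_of_cauchySeq_tendsto fun u hu => ?_
  have hsub (m n : ℕ) (z : ℂ) : dist (u m z) (u n z) ≤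
      Real.exp ((‖z‖ + 1) ^ 2) * dist (u m) (u n) := by
    have h := norm_apply_le (u m - u n) z
    rwa [map_sub, Pi.sub_apply, ← dist_eq_norm, ← dist_eq_norm] at h
  have hpt (z : ℂ) : CauchySeq fun n => u n z := by
    rw [Metric.cauchySeq_iff] at hu ⊢
    intro ε hε
    obtain ⟨N, hN⟩ := hu (ε / Real.exp ((‖z‖ + 1) ^ 2)) (by positivity)
    refine ⟨N, fun m hm n hn => (hsub m n z).trans_lt ?_⟩
    have := hN m hm n hn
    rwa [lt_div_iff₀' (by positivity)] at this
  choose g hg using fun z => cauchySeq_tendsto_of_complete (hpt z)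
  have hunif : TendstoLocallyUniformlyOn (fun n => (u n : ℂ → ℂ)) g atTop Set.univ := by
    rw [tendstoLocallyUniformlyOn_univ, tendstoLocallyUniformly_iff_forall_isCompact]
    intro K hK
    obtain ⟨R, hR⟩ := hK.isBounded.exists_norm_le
    rw [Metric.tendstoUniformlyOn_iff]
    intro ε hε
    obtain ⟨N, hN⟩ := Metric.cauchySeq_iff.1 hu (ε / 2 / Real.exp ((|R| + 1) ^ 2)) (by positivity)
    filter_upwards [eventually_ge_atTop N] with n hn z hz
    have hle : dist (g z) (u n z) ≤ ε / 2 := by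
      refine le_of_tendsto ((hg z).dist tendsto_const_nhds) ?_
      filter_upwards [eventually_ge_atTop N] with m hm
      refine (hsub m n z).trans ?_
      have h1 := (hN m hm n hn).le
      rw [le_div_iff₀' (by positivity)] at h1
      refine le_trans ?_ h1
      gcongr
      exact (hR z hz).trans (le_abs_self R)
    linarith
  have hgd : Differentiable ℂ g := by
    rw [← differentiableOn_univ]
    exact hunif.differentiableOn
      (Eventually.of_forall fun n => (u n).differentiable.differentiableOn) isOpen_univ
  have hiso : Isometry toL2 := AddMonoidHomClass.isometry_of_norm toL2 fun f => (norm_def f).symm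
  have hcL : CauchySeq fun n => toL2 (u n) := hu.map hiso.uniformContinuous
  obtain ⟨F, hF⟩ := cauchySeq_tendsto_of_complete hcL
  obtain ⟨ns, hns, hae⟩ := (tendstoInMeasure_of_tendsto_Lp hF).exists_seq_tendsto_ae
  have hgF : F =ᵐ[gaussianMeasure] g := by
    filter_upwards [hae, ae_all_iff.2 fun n => coeFn_toL2 (u n)] with z hz hn
    refine tendsto_nhds_unique hz ?_
    simp only [hn]
    exact (hg z).comp hns.tendsto_atTop
  have hgm : g ∈ fockSubmodule := ⟨hgd, (memLp_congr_ae hgF).1 (Lp.memLp F)⟩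
  refine ⟨FockSpace.mk g hgm, hiso.isEmbedding.tendsto_nhds_iff.2 ?_⟩
  have hFg : toL2 (FockSpace.mk g hgm) = F :=
    Lp.ext ((coeFn_toL2 _).trans hgF.symm)
  rw [hFg]
  exact hF

/-- The formal weighted composition expression `E(ψ, φ) f = ψ · (f ∘ φ)`. -/
def weightedCompExpr (ψ φ : ℂ → ℂ) : FockSpace →ₗ[ℂ] (ℂ → ℂ) where
  toFun f z := ψ z * f (φ z)
  map_add' f g := by
    funext z
    simp [mul_add]
  map_smul' c f := by
    funext z
    simp [mul_left_comm]

/-- The maximal weighted composition operator `W f = E(ψ, φ) f`, with domain all `f` in the Fock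
space for which `E(ψ, φ) f` again belongs to the Fock space. -/
def maxWeightedComp (ψ φ : ℂ → ℂ) : FockSpace →ₗ.[ℂ] FockSpace where
  domain := fockSubmodule.comap (weightedCompExpr ψ φ)
  toFun :=
    { toFun := fun f => FockSpace.mk (weightedCompExpr ψ φ f) f.2
      map_add' := fun f g => FockSpace.ext fun z => by simp
      map_smul' := fun c f => FockSpace.ext fun z => by simp }

theorem mem_domain_maxWeightedComp {ψ φ : ℂ → ℂ} {f : FockSpace} :
    f ∈ (maxWeightedComp ψ φ).domain ↔ (fun z => ψ z * f (φ z)) ∈ fockSubmodule := Iff.rfl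

theorem maxWeightedComp_apply (ψ φ : ℂ → ℂ) (f : (maxWeightedComp ψ φ).domain) (z : ℂ) :
    maxWeightedComp ψ φ f z = ψ z * (f : FockSpace) (φ z) := rfl

/-- A linear operator is Hermitian if it is closed, densely defined and equal to its adjoint. -/
def IsHermitian (T : FockSpace →ₗ.[ℂ] FockSpace) : Prop :=
  T.IsClosed ∧ Dense (T.domain : Set FockSpace) ∧ T = T.adjoint

end Fock

end

open MeasureTheory Filter Topology
open scoped ComplexConjugate ENNReal

noncomputable section

namespace Fock

/-! ### The reproducing kernel of the Fock space -/

/-! Everything is tested on the reproducing kernels `K_w(z) = e^{w̄z}`: evaluating `Wf` at `w` gives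
`W* K_w = conj ψ(w) • K_{φ(w)}`. If `W* ≤ W`, this must equal `ψ · (K_w ∘ φ)`, a functional equation
in `w` and `z` that forces the affine and exponential shapes (`exists_affine_symbols`).

Conversely, for such symbols `W K_w = conj ψ(w) • K_{φ(w)}` as well. Hence `W` is densely defined,
and pairing `W* g` with `K_z` gives `W* g = ψ · (g ∘ φ)`, so `W* ≤ W`. Thus `W*` is closed and
symmetric, and equality follows once `W* + i` has dense range and `W + i` is injective
(`eq_adjoint_of_adjoint_le`). Both reduce to the absence of nonzero solutions in the Fock space of
`ψ · (f ∘ φ) = ±i f` (`eq_zero_of_affine`), proved at a fixed point of `φ` when `A ≠ 1` and by a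
Liouville argument when `φ` is a translation. -/

theorem measurePreserving_mul_left {c : ℂ} (hc : ‖c‖ = 1) :
    MeasurePreserving (fun z => c * z) gaussianMeasure gaussianMeasure := by
  have hvol : MeasurePreserving (fun z : ℂ => c * z) volume volume :=
    (rotation ⟨c, by simpa [Submonoid.unitSphere] using hc⟩).measurePreserving
  refine ⟨by fun_prop, Measure.ext fun s hs => ?_⟩
  rw [Measure.map_apply (by fun_prop) hs, gaussianMeasure,
    withDensity_apply _ (hvol.measurable hs), withDensity_apply _ hs,
    ← hvol.setLIntegral_comp_preimage hs measurable_density]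
  simp [hc]

theorem integral_gaussianMeasure (F : ℂ → ℂ) :
    ∫ z, F z ∂gaussianMeasure = ∫ z, (Real.pi⁻¹ * Real.exp (-‖z‖ ^ 2)) • F z := by
  rw [gaussianMeasure, integral_withDensity_eq_integral_toReal_smul measurable_density
    (Eventually.of_forall fun _ => ENNReal.ofReal_lt_top)]
  refine integral_congr_ae (Eventually.of_forall fun z => ?_)
  dsimp only
  rw [ENNReal.toReal_ofReal (by positivity)]

theorem integrable_gaussianMeasure_iff {E : Type*} [NormedAddCommGroup E] [NormedSpace ℝ E]
    {F : ℂ → E} :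
    Integrable F gaussianMeasure ↔
      Integrable fun z => (Real.pi⁻¹ * Real.exp (-‖z‖ ^ 2)) • F z := by
  rw [gaussianMeasure, integrable_withDensity_iff_integrable_smul' measurable_density
    (Eventually.of_forall fun _ => ENNReal.ofReal_lt_top)]
  refine integrable_congr (Eventually.of_forall fun z => ?_)
  dsimp only
  rw [ENNReal.toReal_ofReal (by positivity)]

/-- The mean value property with respect to the Gaussian measure. -/
theorem integral_eq_apply_zero {g : ℂ → ℂ} (hg : Differentiable ℂ g)
    (hi : Integrable g gaussianMeasure) : ∫ z, g z ∂gaussianMeasure = g 0 := by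
  have hu (θ : ℝ) : ‖circleMap 0 1 θ‖ = 1 := by simp
  have hrot {E : Type} [NormedAddCommGroup E] [NormedSpace ℝ E] (F : ℂ → E)
      (hF : AEStronglyMeasurable F gaussianMeasure) (θ : ℝ) :
      ∫ z, F (circleMap 0 1 θ * z) ∂gaussianMeasure = ∫ z, F z ∂gaussianMeasure := by
    have h := measurePreserving_mul_left (hu θ)
    conv_rhs => rw [← h.map_eq]
    rw [integral_map h.aemeasurable (by rwa [h.map_eq])]
  -- Average over rotations of `z`: each average is `g 0` by the mean value property of `u ↦ g (u *
  -- z)`, and rotation invariance with Fubini transfers this to the Gaussian integral.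
  have hcirc (z : ℂ) :
      ∫ θ in (0 : ℝ)..2 * Real.pi, g (circleMap 0 1 θ * z) = (2 * Real.pi : ℝ) • g 0 := by
    have h : Differentiable ℂ fun u => g (u * z) := by fun_prop
    have h1 : Real.circleAverage (fun u => g (u * z)) 0 1 = g (0 * z) :=
      h.diffContOnCl.circleAverage
    rw [Real.circleAverage, zero_mul] at h1
    rw [← h1, smul_smul, mul_inv_cancel₀ (by positivity), one_smul]
  have hcont : Continuous fun p : ℝ × ℂ => g (circleMap 0 1 p.1 * p.2) := by
    have := continuous_circleMap 0 1
    have := hg.continuous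
    fun_prop
  have hprod : Integrable (Function.uncurry fun (θ : ℝ) (z : ℂ) => g (circleMap 0 1 θ * z))
      ((volume.restrict (Set.Ioc 0 (2 * Real.pi))).prod gaussianMeasure) := by
    rw [integrable_prod_iff (by exact hcont.aestronglyMeasurable)]
    refine ⟨Eventually.of_forall fun θ => ?_, ?_⟩
    · exact (measurePreserving_mul_left (hu θ)).integrable_comp_of_integrable hi
    · simp only [Function.uncurry]
      simp_rw [hrot (fun z => ‖g z‖) hi.1.norm]
      exact integrable_const _
  have h := integral_integral_swap hprod
  simp_rw [← intervalIntegral.integral_of_le Real.two_pi_pos.le, hrot g hi.1, hcirc] at h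
  simp only [intervalIntegral.integral_const, sub_zero, integral_const, probReal_univ,
    one_smul] at h
  exact smul_right_injective ℂ (by positivity : 2 * Real.pi ≠ 0) h

theorem memLp_exp (w : ℂ) : MemLp (fun z => Complex.exp (conj w * z)) 2 gaussianMeasure := by
  have hc : Continuous fun z => Complex.exp (conj w * z) := by fun_prop
  rw [memLp_two_iff_integrable_sq_norm hc.aestronglyMeasurable, integrable_gaussianMeasure_iff]
  -- The coefficient 2 comes from squaring: `|e^{w̄z}|² = e^{2 Re(w̄z)}`.
  have h := (GaussianFourier.integrable_cexp_neg_mul_sq_norm_add (V := ℂ) (b := 1) (by simp)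
    2 w).norm.const_mul Real.pi⁻¹
  refine h.congr (Eventually.of_forall fun z => ?_)
  simp only [Complex.norm_exp, smul_eq_mul, mul_assoc, ← Real.exp_nat_mul, ← Real.exp_add]
  congr 2
  simp [Complex.inner, ← Complex.ofReal_pow]
  ring

/-- The reproducing kernel `K_w(z) = e^{w̄ z}` of the Fock space. -/
def kernel (w : ℂ) : FockSpace :=
  FockSpace.mk (fun z => Complex.exp (conj w * z)) ⟨by fun_prop, memLp_exp w⟩

theorem kernel_apply (w z : ℂ) : kernel w z = Complex.exp (conj w * z) := rfl

/-- Translating by `w` completes the square: the integral becomes the Gaussian mean of the entire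
function `f (z + w) e^{-w̄z}`, whose value at 0 is `f w`. -/
theorem inner_kernel_left (w : ℂ) (f : FockSpace) : inner ℂ (kernel w) f = f w := by
  have hi : Integrable (fun z => conj (kernel w z) * f z) gaussianMeasure := by
    have h := (MemLp.star (kernel w).memLp).integrable_mul f.memLp
    exact h
  have hd : Differentiable ℂ fun z => f (z + w) * Complex.exp (-(conj w * z)) := by
    have := f.differentiable
    fun_prop
  have key (z : ℂ) : (Real.pi⁻¹ * Real.exp (-‖z + w‖ ^ 2)) • (conj (kernel w (z + w)) * f (z + w)) =
      (Real.pi⁻¹ * Real.exp (-‖z‖ ^ 2)) • (f (z + w) * Complex.exp (-(conj w * z))) := by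
    rw [kernel_apply, ← Complex.exp_conj, Complex.real_smul, Complex.real_smul]
    push_cast
    have h : Complex.exp (-(‖z + w‖ : ℂ) ^ 2) * Complex.exp (conj (conj w * (z + w))) =
        Complex.exp (-(‖z‖ : ℂ) ^ 2) * Complex.exp (-(conj w * z)) := by
      rw [← Complex.exp_add, ← Complex.exp_add]
      congr 1
      simp only [← Complex.conj_mul', map_mul, map_add, Complex.conj_conj]
      ring
    linear_combination (Real.pi : ℂ)⁻¹ * f (z + w) * h
  have hi' : Integrable (fun z => f (z + w) * Complex.exp (-(conj w * z))) gaussianMeasure := by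
    rw [integrable_gaussianMeasure_iff] at hi ⊢
    exact (hi.comp_add_right w).congr (Eventually.of_forall key)
  have h := integral_eq_apply_zero hd hi'
  rw [inner_def, integral_gaussianMeasure, ← integral_add_right_eq_self _ w]
  rw [integral_gaussianMeasure] at h
  simp_rw [key, h]
  simp

theorem inner_kernel_right (w : ℂ) (f : FockSpace) : inner ℂ f (kernel w) = conj (f w) := by
  rw [← inner_kernel_left, inner_conj_symm]

/-- Cauchy–Schwarz against the kernel. The exponent `‖z‖² / 2` is what the Liouville argument in
`eq_zero_of_translation` needs; the cruder `norm_apply_le` would not do. -/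
theorem norm_apply_le_exp (f : FockSpace) (z : ℂ) :
    ‖f z‖ ≤ ‖f‖ * Real.exp (‖z‖ ^ 2 / 2) := by
  have h1 : ‖kernel z‖ ^ 2 = Real.exp (‖z‖ ^ 2 / 2) ^ 2 := by
    rw [← inner_self_eq_norm_sq (𝕜 := ℂ), inner_kernel_left, kernel_apply, Complex.conj_mul',
      ← Complex.ofReal_pow, ← Complex.ofReal_exp, ← Real.exp_nat_mul]
    simp only [RCLike.re_to_complex, Complex.ofReal_re]
    congr 1
    push_cast
    ring
  have h2 : ‖kernel z‖ = Real.exp (‖z‖ ^ 2 / 2) :=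
    (sq_eq_sq₀ (norm_nonneg _) (Real.exp_pos _).le).1 h1
  rw [← inner_kernel_left, ← h2, mul_comm]
  exact norm_inner_le_norm _ _

theorem dense_of_kernel_mem {p : Submodule ℂ FockSpace} (hp : ∀ w, kernel w ∈ p) :
    Dense (p : Set FockSpace) := by
  rw [Submodule.dense_iff_topologicalClosure_eq_top, Submodule.topologicalClosure_eq_top_iff,
    Submodule.eq_bot_iff]
  refine fun f hf => FockSpace.ext fun z => ?_
  rw [← inner_kernel_left, (Submodule.mem_orthogonal _ _).1 hf _ (hp z)]
  rfl

/-! ### A criterion for self-adjointness -/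

/-- If the adjoint of a densely defined operator `T` is contained in `T`, the range of
`T† + i` is dense, and `T + i` is injective, then `T` is self-adjoint. -/
theorem eq_adjoint_of_adjoint_le {H : Type*} [NormedAddCommGroup H] [InnerProductSpace ℂ H]
    [CompleteSpace H] {T : H →ₗ.[ℂ] H} (hT : Dense (T.domain : Set H)) (hle : T.adjoint ≤ T)
    (hrange : ∀ h : H, (∀ g : T.adjoint.domain, inner ℂ (T.adjoint g + Complex.I • (g : H)) h = 0) →
      h = 0)
    (hinj : ∀ f : T.domain, T f + Complex.I • (f : H) = 0 → (f : H) = 0) :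
    T = T.adjoint := by
  have hsymm (g : T.adjoint.domain) :
      inner ℂ (T.adjoint g) (g : H) = inner ℂ (g : H) (T.adjoint g) := by
    have h := LinearPMap.adjoint_isFormalAdjoint hT g ⟨g, hle.1 g.2⟩
    rwa [← hle.2 (x := g) rfl] at h
  have hnorm (g : T.adjoint.domain) :
      ‖T.adjoint g + Complex.I • (g : H)‖ ^ 2 = ‖T.adjoint g‖ ^ 2 + ‖(g : H)‖ ^ 2 := by
    -- By symmetry `⟨T† g, g⟩` is real, so the cross term is purely imaginary.
    have h1 : RCLike.re (inner ℂ (T.adjoint g) (Complex.I • (g : H))) = 0 := by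
      have h2 := inner_conj_symm (𝕜 := ℂ) (T.adjoint g) (g : H)
      rw [← hsymm, Complex.conj_eq_iff_im] at h2
      rw [inner_smul_right]
      simp [h2]
    rw [norm_add_sq (𝕜 := ℂ), h1, norm_smul, Complex.norm_I]
    ring
  -- On the graph, complete because `T†` is closed, `T† + i` is bounded and bounded below, hence has
  -- closed range.
  let L : T.adjoint.graph →L[ℂ] H :=
    (ContinuousLinearMap.snd ℂ H H + Complex.I • ContinuousLinearMap.fst ℂ H H).comp
      T.adjoint.graph.subtypeL
  have hL (g : T.adjoint.domain) :
      L ⟨((g : H), T.adjoint g), T.adjoint.mem_graph g⟩ = T.adjoint g + Complex.I • (g : H) := rfl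
  have hanti : AntilipschitzWith 1 L := by
    refine AddMonoidHomClass.antilipschitz_of_bound L fun ⟨p, hp⟩ => ?_
    obtain ⟨g, rfl⟩ := T.adjoint.mem_graph_iff'.1 hp
    rw [hL]
    simp only [NNReal.coe_one, one_mul, Submodule.coe_norm]
    have h := hnorm g
    refine max_le ?_ ?_ <;> refine le_of_sq_le_sq ?_ (norm_nonneg _) <;>
      nlinarith [sq_nonneg ‖T.adjoint g‖, sq_nonneg ‖(g : H)‖]
  have hcl : IsClosed (T.adjoint.graph : Set (H × H)) := LinearPMap.adjoint_isClosed hT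
  have : CompleteSpace T.adjoint.graph := hcl.completeSpace_coe
  have hrcl : IsClosed (L.range : Set H) := by
    have h := hanti.isClosed_range L.uniformContinuous
    exact h
  have htop : L.range = ⊤ := by
    rw [← hrcl.submodule_topologicalClosure_eq, Submodule.topologicalClosure_eq_top_iff,
      Submodule.eq_bot_iff]
    exact fun h hh => hrange h fun g =>
      (Submodule.mem_orthogonal _ _).1 hh _ ⟨⟨_, T.adjoint.mem_graph g⟩, hL g⟩
  refine (LinearPMap.eq_of_le_of_domain_eq hle (le_antisymm hle.1 fun f hf => ?_)).symm
  obtain ⟨⟨p, hp⟩, hpf⟩ : T ⟨f, hf⟩ + Complex.I • f ∈ L.range := htop ▸ Submodule.mem_top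
  obtain ⟨g, rfl⟩ := T.adjoint.mem_graph_iff'.1 hp
  have h1 : T.adjoint g + Complex.I • (g : H) = T ⟨f, hf⟩ + Complex.I • f := hpf
  have h2 : T.adjoint g = T ⟨g, hle.1 g.2⟩ := hle.2 rfl
  -- Surjectivity of `T† + i` gave `g` with the same image as `f`; injectivity of `T + i` identifies
  -- them.
  have h3 := hinj (⟨f, hf⟩ - ⟨g, hle.1 g.2⟩) (by
    rw [LinearPMap.map_sub, ← h2, Submodule.coe_sub, smul_sub, ← add_sub_add_comm, h1, sub_self])
  have h4 : f = g := sub_eq_zero.1 h3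
  exact h4 ▸ g.2

/-! ### Eigenfunctions of weighted composition operators with affine symbols -/

theorem ofReal_sq_ne_neg_one (r : ℝ) : (r : ℂ) ^ 2 ≠ -1 := by
  intro h
  have h1 : r ^ 2 = -1 := by exact_mod_cast h
  linarith [sq_nonneg r]

/-- Compare leading Taylor coefficients at the fixed point `p = B / (1 - A)`: a zero of order `n`
there forces `v = C e^{B̄p} Aⁿ`, which is real since `B̄p` is. -/
theorem eq_zero_of_dilation {C A : ℝ} {B v : ℂ} (hA : A ≠ 1) (hv : v ^ 2 = -1) {f : ℂ → ℂ}
    (hf : Differentiable ℂ f)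
    (h : ∀ z, C * Complex.exp (conj B * z) * f (A * z + B) = v * f z) (z : ℂ) : f z = 0 := by
  have hA' : (1 - A : ℂ) ≠ 0 := by
    rw [sub_ne_zero]
    exact_mod_cast hA.symm
  set p : ℂ := B / (1 - A) with hp
  have hpB : A * p + B = p := by
    rw [hp]
    field_simp
    ring
  have hBp : conj B * p = (‖B‖ ^ 2 / (1 - A) : ℝ) := by
    rw [hp, ← mul_div_assoc, Complex.conj_mul']
    push_cast
    rfl
  have han : AnalyticOnNhd ℂ f Set.univ := fun z _ => hf.analyticAt z
  by_contra hz
  obtain ⟨n, g, hg, hg0, hfg⟩ := (hf.analyticAt p).exists_eventuallyEq_pow_smul_nonzero_iff.2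
    fun hev => hz (congrFun (han.eq_of_eventuallyEq (g := 0) analyticOnNhd_const hev) z)
  have haff : Tendsto (fun z : ℂ => A * z + B) (𝓝 p) (𝓝 p) := by
    have : ContinuousAt (fun z : ℂ => A * z + B) p := by fun_prop
    simpa only [ContinuousAt, hpB] using this
  -- The factor `(z - p)ⁿ` cancels only off `p`; the value at `p` is recovered by a limit.
  have hev : ∀ᶠ z in 𝓝[≠] p,
      C * Complex.exp (conj B * z) * (A ^ n * g (A * z + B)) = v * g z := by
    filter_upwards [hfg.filter_mono nhdsWithin_le_nhds,
      (haff.eventually hfg).filter_mono nhdsWithin_le_nhds, self_mem_nhdsWithin] with z h1 h2 h3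
    have h4 : A * z + B - p = A * (z - p) := by linear_combination hpB
    have h5 := h z
    rw [h1, h2, h4, mul_pow, smul_eq_mul, smul_eq_mul] at h5
    have h6 : (z - p) ^ n ≠ 0 := pow_ne_zero _ (sub_ne_zero.2 h3)
    refine mul_left_cancel₀ h6 ?_
    linear_combination h5
  have hgaff : Tendsto (fun z => g (A * z + B)) (𝓝 p) (𝓝 (g p)) :=
    hg.continuousAt.tendsto.comp haff
  have hexp : Tendsto (fun z => C * Complex.exp (conj B * z)) (𝓝 p)
      (𝓝 (C * Complex.exp (conj B * p))) := by
    have : Continuous fun z => C * Complex.exp (conj B * z) := by fun_prop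
    exact this.tendsto p
  have hl := (hexp.mul (hgaff.const_mul ((A : ℂ) ^ n))).mono_left
    (nhdsWithin_le_nhds (s := {p}ᶜ))
  have hr := (hg.continuousAt.tendsto.const_mul v).mono_left (nhdsWithin_le_nhds (s := {p}ᶜ))
  have heq := tendsto_nhds_unique (hl.congr' hev) hr
  rw [← mul_assoc, mul_left_inj' hg0, hBp, ← Complex.ofReal_exp, ← Complex.ofReal_mul,
    ← Complex.ofReal_pow, ← Complex.ofReal_mul] at heq
  exact ofReal_sq_ne_neg_one _ (heq ▸ hv)

/-- A Gaussian factor turns the equation into `P (t + 1) = ω P t` with `|ω| = 1` and `ω ≠ 1`. The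
growth bound makes `P` bounded on a period strip, so `P` is constant by Liouville, hence zero. -/
theorem eq_zero_of_translation {C : ℝ} {B v : ℂ} (hC : C ≠ 0) (hB : B ≠ 0) (hv : v ^ 2 = -1)
    {f : ℂ → ℂ} (hf : Differentiable ℂ f) {M : ℝ}
    (hM : ∀ z, ‖f z‖ ≤ M * Real.exp (‖z‖ ^ 2 / 2))
    (h : ∀ z, C * Complex.exp (conj B * z) * f (z + B) = v * f z) (z : ℂ) : f z = 0 := by
  have hM0 : 0 ≤ M := by simpa using (norm_nonneg _).trans (hM 0)
  have hvn : ‖v‖ = 1 := by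
    have h1 : ‖v‖ ^ 2 = 1 := by rw [← norm_pow, hv]; simp
    nlinarith [norm_nonneg v]
  have hC' : (C : ℂ) ≠ 0 := by exact_mod_cast hC
  set b : ℝ := ‖B‖ ^ 2 with hb
  have hbB : conj B * B = b := by rw [Complex.conj_mul', hb]; push_cast; rfl
  -- Chosen so that the multiplier `ω = v |C| / C` of `P` has modulus one.
  set β : ℝ := b / 2 - Real.log |C| with hβ
  let P : ℂ → ℂ := fun t => f (B * t) * Complex.exp (b * t ^ 2 / 2 - β * t)
  have hPd : Differentiable ℂ P := by fun_prop
  have hPt (t : ℂ) : P (t + 1) = v * (|C| : ℝ) / C * P t := by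
    have h1 := h (B * t)
    rw [← mul_assoc, hbB] at h1
    have h2 : Complex.exp (b * (t + 1) ^ 2 / 2 - β * (t + 1)) =
        Complex.exp (b * t ^ 2 / 2 - β * t) * Complex.exp (b * t) * (|C| : ℝ) := by
      have h3 : ((|C| : ℝ) : ℂ) = Complex.exp (b / 2 - β) := by
        rw [hβ]
        push_cast
        rw [sub_sub_cancel, ← Complex.ofReal_exp, Real.exp_log (abs_pos.2 hC)]
      rw [h3, ← Complex.exp_add, ← Complex.exp_add]
      congr 1
      ring
    simp only [P]
    rw [h2, mul_add, mul_one]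
    rw [div_mul_eq_mul_div, eq_div_iff hC']
    linear_combination (|C| : ℝ) * Complex.exp (b * t ^ 2 / 2 - β * t) * h1
  have hω : ‖v * (|C| : ℝ) / C‖ = 1 := by
    simp [hvn, hC]
  have hper : Function.Periodic (fun t => ‖P t‖) 1 := fun t => by
    simp only
    rw [hPt, norm_mul, hω, one_mul]
  have hPb (t : ℂ) : ‖P t‖ ≤ M * Real.exp (b + |β|) := by
    have h1 : ‖P (t - ⌊t.re⌋ * 1)‖ = ‖P t‖ := hper.sub_int_mul_eq _
    rw [← h1]
    set s : ℂ := t - ⌊t.re⌋ * 1 with hs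
    have hre : s.re = Int.fract t.re := by simp [hs]
    have h0 : 0 ≤ s.re := hre ▸ Int.fract_nonneg _
    have h1 : s.re ≤ 1 := hre ▸ (Int.fract_lt_one _).le
    have h2 : ‖P s‖ = ‖f (B * s)‖ * Real.exp (b * (s.re ^ 2 - s.im ^ 2) / 2 - β * s.re) := by
      simp only [P]
      rw [norm_mul, Complex.norm_exp]
      congr 2
      simp [pow_two]
    have hbn : 0 ≤ b := by positivity
    rw [h2]
    calc _ ≤ M * Real.exp (‖B * s‖ ^ 2 / 2) *
          Real.exp (b * (s.re ^ 2 - s.im ^ 2) / 2 - β * s.re) := by gcongr; exact hM _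
      -- The imaginary part cancels exactly between the growth bound and the Gaussian factor.
      _ = M * Real.exp (b * s.re ^ 2 - β * s.re) := by
        rw [mul_assoc, ← Real.exp_add, norm_mul, mul_pow, ← hb, Complex.sq_norm,
          Complex.normSq_apply]
        congr 2
        ring
      _ ≤ M * Real.exp (b + |β|) := by
        gcongr
        have h3 : s.re ^ 2 ≤ 1 := by nlinarith
        have h4 : -(β * s.re) ≤ |β| := by
          refine (neg_le_abs _).trans ?_
          rw [abs_mul, abs_of_nonneg h0]
          exact mul_le_of_le_one_right (abs_nonneg _) h1
        nlinarith
  have hconst := hPd.apply_eq_apply_of_bounded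
    (isBounded_iff_forall_norm_le.2 ⟨_, Set.forall_mem_range.2 hPb⟩)
  have hω1 : v * (|C| : ℝ) / C ≠ 1 := by
    intro h1
    rw [div_eq_one_iff_eq hC'] at h1
    have h2 : (v * (|C| : ℝ)) ^ 2 = (C : ℂ) ^ 2 := by rw [h1]
    rw [mul_pow, hv, ← Complex.ofReal_pow, sq_abs] at h2
    have h3 : (C : ℂ) ^ 2 ≠ 0 := pow_ne_zero _ hC'
    push_cast at h2
    exact h3 (by linear_combination -(1 / 2 : ℂ) * h2)
  have hP0 : P (z / B) = 0 := by
    have h1 := hPt (z / B)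
    rw [hconst (z / B + 1) (z / B)] at h1
    have h2 : (v * (|C| : ℝ) / C - 1) * P (z / B) = 0 := by linear_combination -h1
    exact (mul_eq_zero.1 h2).resolve_left (sub_ne_zero.2 hω1)
  simpa [P, mul_div_cancel₀ _ hB, Complex.exp_ne_zero] using hP0

/-- The numbers `±i` are not eigenvalues of the weighted composition expression with symbols
`C e^{B̄ z}` and `A z + B`. -/
theorem eq_zero_of_affine {C A : ℝ} {B v : ℂ} (hC : C ≠ 0) (hv : v ^ 2 = -1) (f : FockSpace)
    (h : ∀ z, C * Complex.exp (conj B * z) * f (A * z + B) = v * f z) : f = 0 := by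
  refine FockSpace.ext fun z => ?_
  change f z = 0
  by_cases hA : A = 1
  · subst hA
    simp only [Complex.ofReal_one, one_mul] at h
    by_cases hB : B = 0
    · subst hB
      have h1 := h z
      simp only [map_zero, zero_mul, Complex.exp_zero, mul_one, add_zero] at h1
      have h2 : (C : ℂ) - v ≠ 0 := by
        rw [sub_ne_zero]
        rintro rfl
        exact ofReal_sq_ne_neg_one _ hv
      exact (mul_eq_zero.1 (by linear_combination h1 : (C - v) * f z = 0)).resolve_left h2
    · exact eq_zero_of_translation hC hB hv f.differentiable (norm_apply_le_exp f) h z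
  · exact eq_zero_of_dilation hA hv f.differentiable h z

/-! ### Weighted composition operators on kernels -/

variable {ψ φ : ℂ → ℂ}

theorem inner_maxWeightedComp_kernel (w : ℂ) (f : (maxWeightedComp ψ φ).domain) :
    inner ℂ (conj (ψ w) • kernel (φ w)) (f : FockSpace) =
      inner ℂ (kernel w) (maxWeightedComp ψ φ f) := by
  rw [inner_smul_left, inner_kernel_left, inner_kernel_left, Complex.conj_conj,
    maxWeightedComp_apply]

theorem kernel_mem_adjoint_domain (w : ℂ) : kernel w ∈ (maxWeightedComp ψ φ).adjoint.domain :=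
  LinearPMap.mem_adjoint_domain_of_exists _ ⟨_, inner_maxWeightedComp_kernel w⟩

theorem adjoint_apply_kernel (hd : Dense ((maxWeightedComp ψ φ).domain : Set FockSpace)) (w : ℂ) :
    (maxWeightedComp ψ φ).adjoint ⟨kernel w, kernel_mem_adjoint_domain w⟩ =
      conj (ψ w) • kernel (φ w) :=
  LinearPMap.adjoint_apply_eq hd _ (inner_maxWeightedComp_kernel w)

theorem exists_affine_symbols (hφ : Differentiable ℂ φ)
    (hψ0 : ∃ z, ψ z ≠ 0) (hd : Dense ((maxWeightedComp ψ φ).domain : Set FockSpace))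
    (hle : (maxWeightedComp ψ φ).adjoint ≤ maxWeightedComp ψ φ) :
    ∃ (A C : ℝ) (B : ℂ), C ≠ 0 ∧ (∀ z, φ z = A * z + B) ∧
      ∀ z, ψ z = C * Complex.exp (conj B * z) := by
  have key (w z : ℂ) :
      conj (ψ w) * Complex.exp (conj (φ w) * z) = ψ z * Complex.exp (conj w * φ z) := by
    have h : (maxWeightedComp ψ φ).adjoint ⟨kernel w, kernel_mem_adjoint_domain w⟩ =
        maxWeightedComp ψ φ ⟨kernel w, hle.1 (kernel_mem_adjoint_domain w)⟩ := hle.2 rfl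
    rw [adjoint_apply_kernel hd] at h
    have h1 : (conj (ψ w) • kernel (φ w) : FockSpace) z =
        maxWeightedComp ψ φ ⟨kernel w, hle.1 (kernel_mem_adjoint_domain w)⟩ z := by rw [h]
    rwa [map_smul, maxWeightedComp_apply] at h1
  have hreal : conj (ψ 0) = ψ 0 := by simpa using key 0 0
  obtain ⟨C, hC⟩ := Complex.conj_eq_iff_real.1 hreal
  have hψeq (z : ℂ) : ψ z = C * Complex.exp (conj (φ 0) * z) := by
    have h := key 0 z
    rw [hreal, hC] at h
    simpa using h.symm
  have hC0 : (C : ℂ) ≠ 0 := by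
    rintro h0
    obtain ⟨z, hz⟩ := hψ0
    exact hz (by rw [hψeq, h0, zero_mul])
  -- Logarithmic derivative at `z = 0` of both sides of `key`, with `ψ` already known.
  have hφeq (w : ℂ) : conj (φ w) = conj (φ 0) + conj w * deriv φ 0 := by
    have hl : HasDerivAt (fun z => conj (ψ w) * Complex.exp (conj (φ w) * z))
        (conj (ψ w) * conj (φ w)) 0 := by
      have h := (((hasDerivAt_id (0 : ℂ)).const_mul (conj (φ w))).cexp).const_mul (conj (ψ w))
      simpa using h
    have hr : HasDerivAt (fun z => C * Complex.exp (conj (φ 0) * z + conj w * φ z))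
        (C * (Complex.exp (conj w * φ 0) * (conj (φ 0) + conj w * deriv φ 0))) 0 := by
      have h := ((((hasDerivAt_id (0 : ℂ)).const_mul (conj (φ 0))).add
        ((hφ 0).hasDerivAt.const_mul (conj w))).cexp).const_mul (C : ℂ)
      simpa using h
    have heq : (fun z => conj (ψ w) * Complex.exp (conj (φ w) * z)) =
        fun z => C * Complex.exp (conj (φ 0) * z + conj w * φ z) := by
      funext z
      rw [key, hψeq z, Complex.exp_add, mul_assoc]
    have h1 := hl.unique (heq ▸ hr)
    have h2 : conj (ψ w) = C * Complex.exp (conj w * φ 0) := by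
      have h := key w 0
      rw [hψeq 0] at h
      simpa using h
    rw [h2, mul_assoc] at h1
    exact mul_left_cancel₀ (Complex.exp_ne_zero _) (mul_left_cancel₀ hC0 h1)
  -- Conjugating `hφeq` shows that `φ` is affine with slope `conj (deriv φ 0)`, which must also be
  -- its derivative.
  have hA : conj (deriv φ 0) = deriv φ 0 := by
    have h1 (w : ℂ) : φ w = φ 0 + w * conj (deriv φ 0) := by
      have h := congrArg conj (hφeq w)
      simpa using h
    have h2 : HasDerivAt φ (conj (deriv φ 0)) 0 := by
      have h := ((hasDerivAt_id (0 : ℂ)).mul_const (conj (deriv φ 0))).const_add (φ 0)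
      rw [one_mul] at h
      exact h.congr_of_eventuallyEq (Eventually.of_forall h1)
    exact h2.deriv.symm
  obtain ⟨A, hA'⟩ := Complex.conj_eq_iff_real.1 hA
  refine ⟨A, C, φ 0, by exact_mod_cast hC0, fun z => ?_, hψeq⟩
  have h := congrArg conj (hφeq z)
  simp only [map_add, map_mul, Complex.conj_conj, hA', Complex.conj_ofReal] at h
  rw [h]
  ring

theorem isHermitian_of_affine_symbols {A C : ℝ} {B : ℂ} (hC : C ≠ 0)
    (hφ : ∀ z, φ z = A * z + B) (hψ : ∀ z, ψ z = C * Complex.exp (conj B * z)) :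
    IsHermitian (maxWeightedComp ψ φ) := by
  have hker (w : ℂ) : (fun z => ψ z * kernel w (φ z)) =
      (conj (ψ w) • kernel (φ w) : FockSpace) := by
    funext z
    rw [map_smul, Pi.smul_apply, smul_eq_mul, kernel_apply, kernel_apply, hψ, hψ, hφ, hφ, map_mul,
      mul_assoc, mul_assoc, ← Complex.exp_conj, ← Complex.exp_add, ← Complex.exp_add,
      Complex.conj_ofReal]
    congr 2
    simp only [map_add, map_mul, Complex.conj_ofReal, Complex.conj_conj]
    ring
  have hmem (w : ℂ) : kernel w ∈ (maxWeightedComp ψ φ).domain := by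
    rw [mem_domain_maxWeightedComp, hker]
    exact FockSpace.mem _
  have happ (w : ℂ) :
      maxWeightedComp ψ φ ⟨kernel w, hmem w⟩ = conj (ψ w) • kernel (φ w) :=
    FockSpace.ext fun z => congrFun (hker w) z
  have hd := dense_of_kernel_mem hmem
  -- Pair `W* g` with `K_z` and move `W` onto the kernel. Maximality of the domain then yields `W* ≤
  -- W`.
  have hadj (g : (maxWeightedComp ψ φ).adjoint.domain) (z : ℂ) :
      (maxWeightedComp ψ φ).adjoint g z = ψ z * (g : FockSpace) (φ z) := by
    have h := LinearPMap.adjoint_isFormalAdjoint hd g ⟨kernel z, hmem z⟩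
    rw [happ, inner_smul_right, inner_kernel_right, inner_kernel_right] at h
    simpa using congrArg conj h
  have hle : (maxWeightedComp ψ φ).adjoint ≤ maxWeightedComp ψ φ := by
    refine ⟨fun g hg => ?_, fun g f hgf => FockSpace.ext fun z => ?_⟩
    · rw [mem_domain_maxWeightedComp, ← funext (hadj ⟨g, hg⟩)]
      exact FockSpace.mem _
    · rw [hadj, hgf, maxWeightedComp_apply]
  have heq : maxWeightedComp ψ φ = (maxWeightedComp ψ φ).adjoint := by
    refine eq_adjoint_of_adjoint_le hd hle (fun h hh => ?_) fun f hf => ?_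
    · refine eq_zero_of_affine (A := A) (B := B) (v := Complex.I) hC Complex.I_sq h fun z => ?_
      -- Orthogonality to `(W* + i) K_z` for every `z` reads `ψ · (h ∘ φ) = i h`, even though `h` is
      -- not known to lie in the domain of `W`.
      have h1 := hh ⟨kernel z, kernel_mem_adjoint_domain z⟩
      rw [adjoint_apply_kernel hd, inner_add_left, inner_smul_left, inner_smul_left,
        inner_kernel_left, inner_kernel_left, Complex.conj_conj, Complex.conj_I, hψ, hφ] at h1
      linear_combination h1
    · refine eq_zero_of_affine (A := A) (B := B) (v := -Complex.I) hC (by simp) f fun z => ?_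
      have h1 : (maxWeightedComp ψ φ f + Complex.I • (f : FockSpace) : FockSpace) z = 0 := by
        rw [hf]
        rfl
      rw [map_add, map_smul, Pi.add_apply, Pi.smul_apply, smul_eq_mul, maxWeightedComp_apply, hψ,
        hφ] at h1
      linear_combination h1
  exact ⟨heq ▸ LinearPMap.adjoint_isClosed hd, hd, heq⟩

end Fock

end

theorem theorem5p2 (ψ φ : ℂ → ℂ) (hψ : Differentiable ℂ ψ) (hφ : Differentiable ℂ φ)
    (hψ0 : ∃ z, ψ z ≠ 0) :
    List.TFAE [
      Fock.IsHermitian (Fock.maxWeightedComp ψ φ),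
      Dense ((Fock.maxWeightedComp ψ φ).domain : Set Fock.FockSpace) ∧
        (Fock.maxWeightedComp ψ φ).adjoint ≤ Fock.maxWeightedComp ψ φ,
      ∃ (A C : ℝ) (B : ℂ), C ≠ 0 ∧ (∀ z, φ z = A * z + B) ∧
        ∀ z, ψ z = C * Complex.exp (starRingEnd ℂ B * z)] := by
  tfae_have 1 → 2 := fun h => ⟨h.2.1, h.2.2.symm.le⟩
  tfae_have 2 → 3 := fun h => Fock.exists_affine_symbols hφ hψ0 h.1 h.2
  tfae_have 3 → 1 := fun ⟨_, _, _, hC, h1, h2⟩ => Fock.isHermitian_of_affine_symbols hC h1 h2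
  tfae_finish
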